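/- Let $d\ge 1$, let $\Omega\subset\mathbb R^d$ be compact, with interior $\Omega^\circ$ and boundary $\partial\Omega=\Omega\setminus\Omega^\circ$, and let $\mu^+,\mu^-$ be finite positive Borel measures on $\Omega$ concentrated on $\Omega^\circ$ (their masses need not be equal). Let $c:\Omega\times\Omega\to\mathbb R$ be Lipschitz and let $\psi^+,\psi^-\in C(\partial\Omega)$ satisfy $$\psi^-(y)-\psi^+(x)\le c(x,y)\qquad\text{for all }x,y\in\partial\Omega.$$ Let $\mathcal P_0(\mu^+,\mu^-)$ be the set of finite positive Borel measures $\pi$ on $\Omega\times\Omega$ whose first and second marginals $\pi_x,\pi_y$ satisfy $(\pi_x)|_{\Omega^\circ}=\mu^+$ and $(\pi_y)|_{\Omega^\circ}=\mu^-$, and define $$\mathcal T_1=\inf_{\pi\in\mathcal P_0(\mu^+,\mu^-)}\left\{\int_{\Omega\times\Omega}c\,d\pi+\int_{\partial\Omega}\psi^+\,d\pi_x-\int_{\partial\Omega}\psi^-\,d\pi_y\right\},$$ $$\mathcal D_1=\sup\left\{\int_\Omega\varphi^-\,d\mu^--\int_\Omega\varphi^+\,d\mu^+\ :\ \varphi^\pm\in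 C(\Omega),\ \psi^-\le\varphi^-\le\varphi^+\le\psi^+\text{ on }\partial\Omega,\ \varphi^-(y)-\varphi^+(x)\le c(x,y)\ \text{for all } x,y\in\Omega\right\}.$$ Then the infimum $\mathcal T_1$ is attained by some $\pi\in\mathcal P_0(\mu^+,\mu^-)$. If moreover $\psi^-\le\psi^+$ on $\partial\Omega$ (which follows from the inequality above whenever $c(x,x)=0$ for all $x\in\partial\Omega$), then $$\mathcal T_1=\mathcal D_1 .$$ -/

import Mathlib

open MeasureTheory

namespace TariffTransport

/-- Euclidean space of dimension `d`. -/
abbrev E (d : ℕ) : Type := EuclideanSpace ℝ (Fin d)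

variable {d : ℕ}

/-- The set of transport plans with free boundary marginals: finite positive Borel measures `π`
on `Ω × Ω` (that is, on `E d × E d` and carried by `Ω ×ˢ Ω`) whose two marginals, restricted to the
interior of `Ω`, are `μp` and `μm`. -/
def plans (Ω : Set (E d)) (μp μm : Measure (E d)) : Set (Measure (E d × E d)) :=
  {π | IsFiniteMeasure π ∧ π (Ω ×ˢ Ω)ᶜ = 0 ∧
    π.fst.restrict (interior Ω) = μp ∧ π.snd.restrict (interior Ω) = μm}

/-- The total cost of a plan: transport cost, plus import tariffs `ψp`, plus export tariffs
`-ψm`. -/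
noncomputable def planCost (Ω : Set (E d)) (c : E d → E d → ℝ) (ψp ψm : E d → ℝ)
    (π : Measure (E d × E d)) : ℝ :=
  (∫ p in Ω ×ˢ Ω, c p.1 p.2 ∂π) + (∫ x in frontier Ω, ψp x ∂π.fst)
    - ∫ y in frontier Ω, ψm y ∂π.snd

/-- The value of the primal problem, in the extended reals. -/
noncomputable def T1 (Ω : Set (E d)) (c : E d → E d → ℝ) (μp μm : Measure (E d))
    (ψp ψm : E d → ℝ) : EReal :=
  ⨅ π ∈ plans Ω μp μm, (planCost Ω c ψp ψm π : EReal)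

/-- The admissible pairs `(φp, φm)` of the dual problem. -/
def potentials (Ω : Set (E d)) (c : E d → E d → ℝ) (ψp ψm : E d → ℝ) :
    Set ((E d → ℝ) × (E d → ℝ)) :=
  {φ | ContinuousOn φ.1 Ω ∧ ContinuousOn φ.2 Ω ∧
    (∀ x ∈ frontier Ω, ψm x ≤ φ.2 x ∧ φ.2 x ≤ φ.1 x ∧ φ.1 x ≤ ψp x) ∧
    ∀ x ∈ Ω, ∀ y ∈ Ω, -φ.1 x + φ.2 y ≤ c x y}

/-- The dual objective at the pair `(φp, φm)`. -/
noncomputable def dualValue (Ω : Set (E d)) (μp μm : Measure (E d))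
    (φ : (E d → ℝ) × (E d → ℝ)) : ℝ :=
  (∫ y in Ω, φ.2 y ∂μm) - ∫ x in Ω, φ.1 x ∂μp

/-- The value of the dual problem, in the extended reals. -/
noncomputable def D1 (Ω : Set (E d)) (c : E d → E d → ℝ) (μp μm : Measure (E d))
    (ψp ψm : E d → ℝ) : EReal :=
  ⨆ φ ∈ potentials Ω c ψp ψm, (dualValue Ω μp μm φ : EReal)

end TariffTransport

namespace TariffTransport

variable {d : ℕ}

/-! The problem is an infinite linear program. By `harb` a pair of boundary points has cost `c + ψp
- ψm ≥ 0`, so boundary-to-boundary mass may be discarded; what remains has mass at most `μp Ω + μm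
Ω`. Capping the mass by `m` on the primal side corresponds on the dual side to allowing a uniform
violation `l` of the constraint at price `m * l`. For this penalised program
`exists_measure_of_dual_bound` produces an optimal measure by the M. Riesz extension theorem. It
remains to see that the penalty gains nothing. `exists_tightPotential` repairs a violation by moving
both potentials by a continuous `η` with `η ≤ l` and `η = 0` on the frontier, at cost at most `m *
l`; `exists_continuous_modulus` constructs `η`. Potentials are kept equal to `ψp`, `ψm` on the
frontier, so attainment does not need `ψm ≤ ψp`. That inequality only makes tight pairs admissible
for `D1`, and weak duality closes the gap. -/

/-! ### Linear programming duality on a compact space -/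

/-- A positive linear functional on `C(Y, ℝ)`, with `Y` compact, is integration against a finite
measure. -/
theorem exists_measure_of_positive {Y : Type*} [TopologicalSpace Y] [T2Space Y] [CompactSpace Y]
    [MeasurableSpace Y] [BorelSpace Y] (Λ : C(Y, ℝ) →ₗ[ℝ] ℝ) (hΛ : ∀ w, 0 ≤ w → 0 ≤ Λ w) :
    ∃ ρ : Measure Y, IsFiniteMeasure ρ ∧ ∀ w : C(Y, ℝ), ∫ y, w y ∂ρ = Λ w := by
  let J : CompactlySupportedContinuousMap Y ℝ →ₗ[ℝ] C(Y, ℝ) :=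
    { toFun := fun f => f.toContinuousMap
      map_add' := fun _ _ => rfl
      map_smul' := fun _ _ => rfl }
  let Λ' : CompactlySupportedContinuousMap Y ℝ →ₚ[ℝ] ℝ :=
    PositiveLinearMap.mk₀ (Λ.comp J) fun f hf => hΛ _ fun y => hf y
  refine ⟨RealRMK.rieszMeasure Λ', ?_, fun w => ?_⟩
  · have : (RealRMK.rieszMeasure Λ').Regular := inferInstance
    infer_instance
  · exact RealRMK.integral_rieszMeasure Λ' (CompactlySupportedContinuousMap.continuousMapEquiv w)

/-- Linear programming duality over a compact space: if `D` bounds from above the penalised dual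
problem, where the constraint `A v ≤ C` may be relaxed by `l` at the price `m * l`, then there is
a feasible measure of cost at most `D`. -/
theorem exists_measure_of_dual_bound {Y : Type*} [TopologicalSpace Y] [T2Space Y] [CompactSpace Y]
    [MeasurableSpace Y] [BorelSpace Y] {V : Type*} [AddCommGroup V] [Module ℝ V]
    (A : V →ₗ[ℝ] C(Y, ℝ)) (f : V →ₗ[ℝ] ℝ) (C : C(Y, ℝ)) (m D : ℝ)
    (hD : ∀ v l, 0 ≤ l → (∀ y, A v y ≤ C y + l) → f v - m * l ≤ D) :
    ∃ ρ : Measure Y, IsFiniteMeasure ρ ∧ (∀ v, ∫ y, A v y ∂ρ = f v) ∧ ∫ y, C y ∂ρ ≤ D := by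
  -- In `(w, t, l, v)`, `t` homogenises `C` and `l` is a uniform slack. The slack lets the subspace
  -- `w = 0` reach the cone from any point, as Riesz extension requires.
  let s : PointedCone ℝ (C(Y, ℝ) × ℝ × ℝ × V) :=
    { carrier := {p | 0 ≤ p.2.1 ∧ 0 ≤ p.2.2.1 ∧
        ∀ y, 0 ≤ p.1 y + p.2.1 * C y + p.2.2.1 - A p.2.2.2 y}
      zero_mem' := by simp
      add_mem' := by
        rintro ⟨w, t, l, v⟩ ⟨w', t', l', v'⟩ ⟨h1, h2, h3⟩ ⟨h1', h2', h3'⟩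
        refine ⟨add_nonneg h1 h1', add_nonneg h2 h2', fun y => ?_⟩
        have := h3 y
        have := h3' y
        simp only [Prod.mk_add_mk, ContinuousMap.add_apply, map_add] at *
        linarith
      smul_mem' := by
        rintro ⟨a, ha⟩ ⟨w, t, l, v⟩ ⟨h1, h2, h3⟩
        refine ⟨mul_nonneg ha h1, mul_nonneg ha h2, fun y => ?_⟩
        have := mul_nonneg ha (h3 y)
        simp only [Nonneg.mk_smul, Prod.smul_mk, ContinuousMap.smul_apply, map_smul,
          smul_eq_mul] at *
        linarith }
  have hs : ∀ w t l v, (w, t, l, v) ∈ s ↔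
      0 ≤ t ∧ 0 ≤ l ∧ ∀ y, 0 ≤ w y + t * C y + l - A v y := fun _ _ _ _ => Iff.rfl
  let F : (C(Y, ℝ) × ℝ × ℝ × V) →ₗ[ℝ] ℝ :=
    (D • LinearMap.fst ℝ ℝ (ℝ × V) + (m • LinearMap.fst ℝ ℝ V - f ∘ₗ LinearMap.snd ℝ ℝ V) ∘ₗ
      LinearMap.snd ℝ ℝ (ℝ × V)) ∘ₗ LinearMap.snd ℝ _ _
  have hF : ∀ w t l v, F (w, t, l, v) = D * t + (m * l - f v) := fun _ _ _ _ => rfl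
  let P : (C(Y, ℝ) × ℝ × ℝ × V) →ₗ.[ℝ] ℝ := F.toPMap (LinearMap.ker (LinearMap.fst ℝ _ _))
  have hnonneg : ∀ x : P.domain, (x : C(Y, ℝ) × ℝ × ℝ × V) ∈ s → 0 ≤ P x := by
    rintro ⟨⟨w, t, l, v⟩, hw⟩ hx
    have hw : w = 0 := hw
    subst hw
    obtain ⟨ht, hl, hx⟩ := hx
    change 0 ≤ D * t + (m * l - f v)
    simp only [ContinuousMap.zero_apply, zero_add] at hx
    rcases ht.eq_or_lt with rfl | ht
    -- For `t = 0` the pair `(v, l)` is a recession direction: `n` times it is feasible once `‖C‖`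
    -- is added to the slack, so a positive value would make the penalised dual unbounded.
    · by_contra! hlt
      have hpos : 0 < f v - m * l := by linarith
      obtain ⟨n, hn⟩ := exists_nat_gt ((D + m * ‖C‖) / (f v - m * l))
      rw [div_lt_iff₀ hpos] at hn
      have := hD ((n : ℝ) • v) (‖C‖ + n * l) (by positivity) fun y => by
        have h1 := C.norm_coe_le_norm y
        have h2 := neg_le_of_abs_le h1
        have h3 := mul_nonneg (Nat.cast_nonneg (α := ℝ) n) (hx y)
        simp only [map_smul, ContinuousMap.smul_apply, smul_eq_mul]
        linarith
      rw [map_smul, smul_eq_mul] at this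
      linarith
    · have := hD (t⁻¹ • v) (t⁻¹ * l) (by positivity) fun y => by
        have h3 := mul_nonneg (inv_pos.2 ht).le (hx y)
        have h4 : t⁻¹ * (t * C y) = C y := inv_mul_cancel_left₀ ht.ne' _
        simp only [map_smul, ContinuousMap.smul_apply, smul_eq_mul]
        linarith
      have := mul_le_mul_of_nonneg_left this ht.le
      rw [map_smul, smul_eq_mul] at this
      have h5 : t * (t⁻¹ * f v - m * (t⁻¹ * l)) = f v - m * l := by
        field_simp
      linarith
  have hdense : ∀ z, ∃ x : P.domain, (x : C(Y, ℝ) × ℝ × ℝ × V) + z ∈ s := by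
    rintro ⟨w, t, l, v⟩
    refine ⟨⟨(0, -t, ‖w‖ - l, -v), rfl⟩, ?_⟩
    change (0 + w, -t + t, ‖w‖ - l + l, -v + v) ∈ s
    rw [hs]
    refine ⟨by simp, by simp, fun y => ?_⟩
    have := neg_le_of_abs_le (w.norm_coe_le_norm y)
    simp
    linarith
  obtain ⟨g, hg, hgs⟩ := riesz_extension s P hnonneg hdense
  have hg0 : ∀ t l v, g (0, t, l, v) = D * t + (m * l - f v) := fun t l v =>
    hg ⟨(0, t, l, v), rfl⟩
  have hsplit : ∀ w t l v, g (w, t, l, v) = g (w, 0, 0, 0) + (D * t + (m * l - f v)) := by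
    intro w t l v
    rw [← hg0, ← map_add]
    simp
  let Λ : C(Y, ℝ) →ₗ[ℝ] ℝ := g ∘ₗ LinearMap.inl ℝ _ _
  have hΛ : ∀ w, Λ w = g (w, 0, 0, 0) := fun _ => rfl
  obtain ⟨ρ, hρ, hint⟩ := exists_measure_of_positive Λ fun w hw =>
    hgs _ ((hs _ _ _ _).2 ⟨le_rfl, le_rfl, fun y => by simpa using hw y⟩)
  have key : ∀ v, f v ≤ Λ (A v) := fun v => by
    have := hgs (A v, 0, 0, v) ((hs _ _ _ _).2 ⟨le_rfl, le_rfl, fun y => by simp⟩)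
    rw [hsplit] at this
    rw [hΛ]
    linarith
  refine ⟨ρ, hρ, fun v => ?_, ?_⟩
  · rw [hint]
    refine le_antisymm ?_ (key v)
    have := key (-v)
    simp only [map_neg] at this
    linarith
  · rw [hint]
    have := hgs (-C, 1, 0, 0) ((hs _ _ _ _).2 ⟨zero_le_one, le_rfl, fun y => by simp⟩)
    rw [hsplit, ← hΛ, map_neg, map_zero] at this
    linarith

/-! ### A continuous correction vanishing on a closed set -/

/-- A continuous function on `X × X` that is nonpositive on `S × S` is dominated, on `K × K`, by a
sum `η x + η y` with `η` continuous, vanishing on `S`. -/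
theorem exists_continuous_modulus {X : Type*} [PseudoMetricSpace X] {K S : Set X}
    (hK : IsCompact K) (hS : IsClosed S) (hSK : S ⊆ K) (hne : S.Nonempty) (h : X × X → ℝ)
    (hh : Continuous h) (hneg : ∀ x ∈ S, ∀ y ∈ S, h (x, y) ≤ 0) {l : ℝ} (hl : 0 ≤ l)
    (hle : ∀ x ∈ K, ∀ y ∈ K, h (x, y) ≤ l) :
    ∃ η : X → ℝ, Continuous η ∧ (∀ x, η x ≤ l) ∧ (∀ x ∈ S, η x = 0) ∧
      ∀ x ∈ K, ∀ y ∈ K, h (x, y) ≤ η x + η y := by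
  let δ : X → ℝ := fun x => Metric.infDist x S
  have hδ : Continuous δ := Metric.continuous_infDist_pt S
  have hδ0 : ∀ x, 0 ≤ δ x := fun x => Metric.infDist_nonneg
  have hδS : ∀ x, δ x = 0 ↔ x ∈ S := fun x => (hS.mem_iff_infDist_zero hne).symm
  let H : X × X → ℝ := fun p => max (min (h p) l) 0
  have hH : Continuous H := by fun_prop
  have hH0 : ∀ p, 0 ≤ H p := fun p => le_max_right _ _
  have hHl : ∀ p, H p ≤ l := fun p => max_le (min_le_right _ _) hl
  let Δ : X × X → ℝ := fun p => max (δ p.1) (δ p.2)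
  have hΔ : Continuous Δ := by fun_prop
  have hΔ0 : ∀ p, 0 ≤ Δ p := fun p => le_max_of_le_left (hδ0 _)
  have hHΔ : ∀ p, Δ p = 0 → H p = 0 := by
    rintro ⟨x, y⟩ hp
    have h1 : δ x = 0 := le_antisymm ((le_max_left _ _).trans hp.le) (hδ0 x)
    have h2 : δ y = 0 := le_antisymm ((le_max_right _ _).trans hp.le) (hδ0 y)
    exact max_eq_right ((min_le_left _ _).trans (hneg x ((hδS x).1 h1) y ((hδS y).1 h2)))
  -- The fraction is a continuous substitute for the indicator of `Δ p ≤ δ x`: it equals 1 there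
  -- when `δ x > 0`, and 0 for `x ∈ S`. So `η x = sup G x` dominates `H (x, y)` whenever `x` is at
  -- least as far from `S` as `y`.
  let G : X → X × X → ℝ := fun x p => H p * (δ x / max (Δ p) (δ x))
  have hfrac0 : ∀ x p, 0 ≤ δ x / max (Δ p) (δ x) := fun x p =>
    div_nonneg (hδ0 x) (le_max_of_le_right (hδ0 x))
  have hfrac1 : ∀ x p, δ x / max (Δ p) (δ x) ≤ 1 := fun x p =>
    div_le_one_of_le₀ (le_max_right _ _) (le_max_of_le_right (hδ0 x))
  have hG0 : ∀ x p, 0 ≤ G x p := fun x p => mul_nonneg (hH0 p) (hfrac0 x p)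
  have hGH : ∀ x p, G x p ≤ H p := fun x p => mul_le_of_le_one_right (hH0 p) (hfrac1 x p)
  have hG : Continuous (Function.uncurry G) := by
    rw [continuous_iff_continuousAt]
    rintro ⟨x, p⟩
    by_cases hx : max (Δ p) (δ x) = 0
    -- Where the denominator vanishes so does `H`, and `0 ≤ G ≤ H` forces continuity.
    · have hp : H p = 0 := hHΔ p (le_antisymm ((le_max_left _ _).trans hx.le) (hΔ0 p))
      have hGxp : Function.uncurry G (x, p) = 0 := by simp [G, hp]
      rw [ContinuousAt, hGxp]
      refine squeeze_zero (fun q => hG0 q.1 q.2) (fun q => hGH q.1 q.2) ?_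
      rw [← hp]
      exact (hH.comp continuous_snd).continuousAt
    · have c1 : ContinuousAt (fun q : X × X × X => H q.2) (x, p) := by fun_prop
      have c2 : ContinuousAt (fun q : X × X × X => δ q.1) (x, p) := by fun_prop
      have c3 : ContinuousAt (fun q : X × X × X => max (Δ q.2) (δ q.1)) (x, p) := by fun_prop
      exact c1.mul (c2.div c3 hx)
  have hKK := hK.prod hK
  obtain ⟨x₀, hx₀⟩ := hne
  have hKKne : (K ×ˢ K).Nonempty := ⟨(x₀, x₀), hSK hx₀, hSK hx₀⟩
  have hbdd : ∀ x, BddAbove (G x '' (K ×ˢ K)) := fun x =>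
    ⟨l, by rintro _ ⟨p, -, rfl⟩; exact (hGH x p).trans (hHl p)⟩
  have hη0 : ∀ x, 0 ≤ sSup (G x '' (K ×ˢ K)) := fun x =>
    Real.sSup_nonneg (by rintro _ ⟨p, -, rfl⟩; exact hG0 x p)
  have hΔη : ∀ x, ∀ p ∈ K ×ˢ K, Δ p = δ x → H p ≤ sSup (G x '' (K ×ˢ K)) := by
    intro x p hp hpx
    refine le_trans (le_of_eq ?_) (le_csSup (hbdd x) ⟨p, hp, rfl⟩)
    by_cases h0 : δ x = 0
    · simp [G, h0, hHΔ p (hpx.trans h0)]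
    · simp [G, hpx, div_self h0]
  refine ⟨fun x => sSup (G x '' (K ×ˢ K)), hKK.continuous_sSup hG, fun x => ?_, fun x hx => ?_,
    fun x hx y hy => ?_⟩
  · exact csSup_le (hKKne.image _) (by rintro _ ⟨p, -, rfl⟩; exact (hGH x p).trans (hHl p))
  · refine le_antisymm (csSup_le (hKKne.image _) ?_) (hη0 x)
    rintro _ ⟨p, -, rfl⟩
    simp [G, (hδS x).2 hx]
  · have h1 : h (x, y) ≤ H (x, y) := le_max_of_le_left (le_min le_rfl (hle x hx y hy))
    rcases max_choice (δ x) (δ y) with hm | hm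
    · linarith [hΔη x (x, y) ⟨hx, hy⟩ hm, hη0 y]
    · linarith [hΔη y (x, y) ⟨hx, hy⟩ hm, hη0 x]

/-! ### Plans, marginals and weak duality -/

/-- Integration against a marginal of a plan splits into a boundary part and a prescribed interior
part. -/
theorem setIntegral_marginal {Ω : Set (E d)} (hΩ : IsCompact Ω) {π : Measure (E d × E d)}
    [IsFiniteMeasure π] (hπ : π (Ω ×ˢ Ω)ᶜ = 0) {q : E d × E d → E d} (hq : Continuous q)
    (hqΩ : ∀ p ∈ Ω ×ˢ Ω, q p ∈ Ω) {μ : Measure (E d)}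
    (hμ : (π.map q).restrict (interior Ω) = μ) {h : E d → ℝ} (hh : ContinuousOn h Ω) :
    IntegrableOn (fun p => h (q p)) (Ω ×ˢ Ω) π ∧
      ∫ p in Ω ×ˢ Ω, h (q p) ∂π = (∫ x in frontier Ω, h x ∂π.map q) + ∫ x in Ω, h x ∂μ := by
  have hm := hΩ.isClosed.measurableSet
  have hK := hΩ.prod hΩ
  refine ⟨(hh.comp hq.continuousOn hqΩ).integrableOn_compact hK, ?_⟩
  have hfr : frontier Ω = Ω \ interior Ω := hΩ.isClosed.frontier_eq
  have hπK : π.restrict (Ω ×ˢ Ω) = π :=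
    Measure.restrict_eq_self_of_ae_mem (by rw [ae_iff]; exact hπ)
  have hνΩ : (π.map q).restrict Ω = π.map q := by
    refine Measure.restrict_eq_self_of_ae_mem ?_
    rw [ae_iff]
    change π.map q Ωᶜ = 0
    rw [Measure.map_apply hq.measurable hm.compl]
    exact measure_mono_null (fun p hp hpK => hp (hqΩ p hpK)) hπ
  have hint : IntegrableOn h Ω (π.map q) := hh.integrableOn_compact hΩ
  have hμΩ : μ.restrict Ω = (π.map q).restrict (interior Ω) := by
    rw [← hμ, Measure.restrict_restrict hm, Set.inter_eq_right.2 interior_subset]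
  rw [hπK, ← integral_map hq.measurable.aemeasurable (by rw [← hνΩ]; exact hint.1), hμΩ, hfr]
  conv_lhs => rw [← hνΩ, ← Set.sdiff_union_of_subset (interior_subset (s := Ω))]
  exact setIntegral_union Set.disjoint_sdiff_left isOpen_interior.measurableSet
    (hint.mono_set Set.sdiff_subset) (hint.mono_set interior_subset)

theorem setIntegral_fst {Ω : Set (E d)} (hΩ : IsCompact Ω) {μp μm : Measure (E d)}
    {π : Measure (E d × E d)} (hπ : π ∈ plans Ω μp μm) {h : E d → ℝ} (hh : ContinuousOn h Ω) :
    IntegrableOn (fun p => h p.1) (Ω ×ˢ Ω) π ∧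
      ∫ p in Ω ×ˢ Ω, h p.1 ∂π = (∫ x in frontier Ω, h x ∂π.fst) + ∫ x in Ω, h x ∂μp := by
  obtain ⟨_, h0, h1, h2⟩ := hπ
  exact setIntegral_marginal hΩ h0 continuous_fst (fun p hp => hp.1) h1 hh

theorem setIntegral_snd {Ω : Set (E d)} (hΩ : IsCompact Ω) {μp μm : Measure (E d)}
    {π : Measure (E d × E d)} (hπ : π ∈ plans Ω μp μm) {h : E d → ℝ} (hh : ContinuousOn h Ω) :
    IntegrableOn (fun p => h p.2) (Ω ×ˢ Ω) π ∧
      ∫ p in Ω ×ˢ Ω, h p.2 ∂π = (∫ x in frontier Ω, h x ∂π.snd) + ∫ x in Ω, h x ∂μm := by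
  obtain ⟨_, h0, h1, h2⟩ := hπ
  exact setIntegral_marginal hΩ h0 continuous_snd (fun p hp => hp.2) h2 hh

/-- Weak duality. -/
theorem dualValue_le_planCost {Ω : Set (E d)} (hΩ : IsCompact Ω) {μp μm : Measure (E d)}
    {π : Measure (E d × E d)} (hπ : π ∈ plans Ω μp μm) {c : E d → E d → ℝ}
    (hc : ContinuousOn (fun p : E d × E d => c p.1 p.2) (Ω ×ˢ Ω)) {ψp ψm : E d → ℝ}
    (hψp : ContinuousOn ψp (frontier Ω)) (hψm : ContinuousOn ψm (frontier Ω))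
    {φ : (E d → ℝ) × (E d → ℝ)} (h1 : ContinuousOn φ.1 Ω) (h2 : ContinuousOn φ.2 Ω)
    (hb1 : ∀ x ∈ frontier Ω, φ.1 x ≤ ψp x) (hb2 : ∀ x ∈ frontier Ω, ψm x ≤ φ.2 x)
    (hle : ∀ x ∈ Ω, ∀ y ∈ Ω, -φ.1 x + φ.2 y ≤ c x y) :
    dualValue Ω μp μm φ ≤ planCost Ω c ψp ψm π := by
  have hm := hΩ.isClosed.measurableSet
  have hfΩ : frontier Ω ⊆ Ω := hΩ.isClosed.frontier_subset
  have hfc : IsCompact (frontier Ω) := hΩ.of_isClosed_subset isClosed_frontier hfΩ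
  have hfm : MeasurableSet (frontier Ω) := hfc.isClosed.measurableSet
  obtain ⟨i1, e1⟩ := setIntegral_fst hΩ hπ h1
  obtain ⟨i2, e2⟩ := setIntegral_snd hΩ hπ h2
  have := hπ.1
  have k : (∫ p in Ω ×ˢ Ω, φ.2 p.2 ∂π) - ∫ p in Ω ×ˢ Ω, φ.1 p.1 ∂π ≤
      ∫ p in Ω ×ˢ Ω, c p.1 p.2 ∂π := by
    rw [← integral_sub i2 i1]
    refine setIntegral_mono_on (i2.sub i1) (hc.integrableOn_compact (hΩ.prod hΩ)) (hm.prod hm) ?_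
    intro p hp
    linarith [hle p.1 hp.1 p.2 hp.2]
  have k1 : ∫ x in frontier Ω, φ.1 x ∂π.fst ≤ ∫ x in frontier Ω, ψp x ∂π.fst :=
    setIntegral_mono_on ((h1.mono hfΩ).integrableOn_compact hfc) (hψp.integrableOn_compact hfc)
      hfm hb1
  have k2 : ∫ x in frontier Ω, ψm x ∂π.snd ≤ ∫ x in frontier Ω, φ.2 x ∂π.snd :=
    setIntegral_mono_on (hψm.integrableOn_compact hfc) ((h2.mono hfΩ).integrableOn_compact hfc)
      hfm hb2
  simp only [dualValue, planCost]
  linarith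

/-- Transporting everything through one boundary point is a plan. -/
theorem plans_nonempty {Ω : Set (E d)} (hΩ : IsCompact Ω) {x₀ : E d} (hx₀ : x₀ ∈ frontier Ω)
    {μp μm : Measure (E d)} [IsFiniteMeasure μp] [IsFiniteMeasure μm]
    (hμp : μp (interior Ω)ᶜ = 0) (hμm : μm (interior Ω)ᶜ = 0) : (plans Ω μp μm).Nonempty := by
  have hm := hΩ.isClosed.measurableSet
  have hxΩ : x₀ ∈ Ω := hΩ.isClosed.frontier_subset hx₀
  have hxi : x₀ ∉ interior Ω := hx₀.2
  have hsub : Ωᶜ ⊆ (interior Ω)ᶜ := Set.compl_subset_compl.2 interior_subset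
  have hprod : (Ω ×ˢ Ω)ᶜ = (Ωᶜ ×ˢ Set.univ) ∪ (Set.univ ×ˢ Ωᶜ) := by
    ext p; simp [Set.mem_prod]; tauto
  have hdΩ : Measure.dirac x₀ Ωᶜ = 0 := by
    rw [Measure.dirac_apply' _ hm.compl]; simp [hxΩ]
  have hdr : (Measure.dirac x₀).restrict (interior Ω) = 0 := by
    rw [Measure.restrict_eq_zero, Measure.dirac_apply' _ isOpen_interior.measurableSet]
    simp [hxi]
  have hr : ∀ μ : Measure (E d), μ (interior Ω)ᶜ = 0 → μ.restrict (interior Ω) = μ := fun μ h =>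
    Measure.restrict_eq_self_of_ae_mem (by rw [ae_iff]; exact h)
  refine ⟨μp.prod (Measure.dirac x₀) + (Measure.dirac x₀).prod μm, inferInstance, ?_, ?_, ?_⟩
  · rw [hprod]
    refine measure_union_null ?_ ?_ <;>
      simp [Measure.prod_prod, hdΩ, measure_mono_null hsub hμp, measure_mono_null hsub hμm]
  · rw [Measure.fst_add, Measure.restrict_add, Measure.fst, Measure.fst, Measure.map_fst_prod,
      Measure.map_fst_prod, Measure.restrict_smul, Measure.restrict_smul, hdr, hr _ hμp]
    simp
  · rw [Measure.snd_add, Measure.restrict_add, Measure.snd, Measure.snd, Measure.map_snd_prod,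
      Measure.map_snd_prod, Measure.restrict_smul, Measure.restrict_smul, hdr, hr _ hμm]
    simp

/-- A finite measure carried by a closed set is determined on its interior by the integrals of
continuous functions vanishing on the frontier. -/
theorem restrict_interior_eq_of_integral_eq {X : Type*} [PseudoMetricSpace X] [MeasurableSpace X]
    [BorelSpace X] {Ω : Set X} (hΩ : IsClosed Ω) (hne : (frontier Ω).Nonempty) {ν μ : Measure X}
    [IsFiniteMeasure ν] [IsFiniteMeasure μ] (hμ : μ (interior Ω)ᶜ = 0)
    (h : ∀ g : C(X, ℝ), (∀ x ∈ frontier Ω, g x = 0) → ∫ x in Ω, g x ∂ν = ∫ x in Ω, g x ∂μ) :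
    ν.restrict (interior Ω) = μ := by
  have hμr : μ.restrict (interior Ω) = μ :=
    Measure.restrict_eq_self_of_ae_mem (by rw [ae_iff]; exact hμ)
  rw [← hμr]
  refine ext_of_forall_integral_eq_of_IsFiniteMeasure fun f => ?_
  -- Cutoffs of `f` vanishing on the frontier and converging to `f` pointwise in the interior.
  let e : ℕ → C(X, ℝ) := fun n =>
    ⟨fun x => f x * min 1 (n * Metric.infDist x (frontier Ω)),
      f.continuous.mul (continuous_const.min
        (continuous_const.mul (Metric.continuous_infDist_pt _)))⟩
  have he0 : ∀ n, ∀ x ∈ frontier Ω, e n x = 0 := fun n x hx => by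
    simp [e, Metric.infDist_zero_of_mem hx]
  have hi : ∀ (κ : Measure X) n, ∫ x in Ω, e n x ∂κ = ∫ x in interior Ω, e n x ∂κ := by
    intro κ n
    refine (setIntegral_eq_of_subset_of_forall_sdiff_eq_zero hΩ.measurableSet interior_subset
      fun x hx => he0 n x ?_)
    rw [hΩ.frontier_eq]
    exact hx
  have hlim : ∀ κ : Measure X, IsFiniteMeasure κ → Filter.Tendsto
      (fun n => ∫ x in interior Ω, e n x ∂κ) Filter.atTop (nhds (∫ x in interior Ω, f x ∂κ)) := by
    intro κ _
    refine tendsto_integral_of_dominated_convergence (fun _ => ‖f‖)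
      (fun n => (e n).continuous.aestronglyMeasurable) (integrable_const _) (fun n => ?_) ?_
    · refine Filter.Eventually.of_forall fun x => ?_
      have h1 : 0 ≤ min 1 (n * Metric.infDist x (frontier Ω)) :=
        le_min zero_le_one (mul_nonneg n.cast_nonneg Metric.infDist_nonneg)
      calc ‖e n x‖ = ‖f x‖ * min 1 (n * Metric.infDist x (frontier Ω)) := by
            simp only [e, ContinuousMap.coe_mk, norm_mul, Real.norm_of_nonneg h1]
        _ ≤ ‖f x‖ * 1 := by gcongr; exact min_le_left _ _
        _ ≤ ‖f‖ := by rw [mul_one]; exact f.norm_coe_le_norm x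
    · refine (ae_restrict_iff' isOpen_interior.measurableSet).2
        (Filter.Eventually.of_forall fun x hx => ?_)
      have hpos : 0 < Metric.infDist x (frontier Ω) :=
        (isClosed_frontier.notMem_iff_infDist_pos hne).1 fun hxf => hxf.2 hx
      obtain ⟨N, hN⟩ := exists_nat_gt (Metric.infDist x (frontier Ω))⁻¹
      refine tendsto_const_nhds.congr' ?_
      filter_upwards [Filter.eventually_ge_atTop N] with n hn
      have : 1 ≤ n * Metric.infDist x (frontier Ω) := by
        rw [← inv_le_iff_one_le_mul₀ hpos]
        exact hN.le.trans (Nat.cast_le.2 hn)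
      simp [e, min_eq_left this]
  refine tendsto_nhds_unique (hlim ν inferInstance) ((hlim μ inferInstance).congr fun n => ?_)
  rw [← hi, ← hi, h (e n) (he0 n)]

/-! ### Tight potentials and strong duality -/

/-- The admissible pairs that agree with the tariffs on the frontier. -/
def tightPotentials (Ω : Set (E d)) (c : E d → E d → ℝ) (ψp ψm : E d → ℝ) :
    Set ((E d → ℝ) × (E d → ℝ)) :=
  {φ | ContinuousOn φ.1 Ω ∧ ContinuousOn φ.2 Ω ∧
    (∀ x ∈ frontier Ω, φ.1 x = ψp x ∧ φ.2 x = ψm x) ∧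
    ∀ x ∈ Ω, ∀ y ∈ Ω, -φ.1 x + φ.2 y ≤ c x y}

theorem tightPotentials_subset_potentials {Ω : Set (E d)} {c : E d → E d → ℝ} {ψp ψm : E d → ℝ}
    (hψ : ∀ x ∈ frontier Ω, ψm x ≤ ψp x) :
    tightPotentials Ω c ψp ψm ⊆ potentials Ω c ψp ψm := by
  rintro φ ⟨h1, h2, h3, h4⟩
  refine ⟨h1, h2, fun x hx => ?_, h4⟩
  obtain ⟨e1, e2⟩ := h3 x hx
  rw [e1, e2]
  exact ⟨le_rfl, hψ x hx, le_rfl⟩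

/-- Integration over a compact set as a linear functional on continuous functions. -/
noncomputable def setIntegralLinear {X : Type*} [TopologicalSpace X] [T2Space X]
    [MeasurableSpace X] [BorelSpace X] {Ω : Set X} (hΩ : IsCompact Ω) (μ : Measure X)
    [IsFiniteMeasure μ] : C(X, ℝ) →ₗ[ℝ] ℝ where
  toFun g := ∫ x in Ω, g x ∂μ
  map_add' g g' := integral_add (g.continuous.continuousOn.integrableOn_compact hΩ)
    (g'.continuous.continuousOn.integrableOn_compact hΩ)
  map_smul' a _ := integral_const_mul a _

/-- A potential violating the transport constraint by at most `l` can be corrected inside `Ω`, at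
a price of at most `l` times the total mass, without changing its boundary values. -/
theorem exists_tightPotential {Ω : Set (E d)} (hΩ : IsCompact Ω) (hne : (frontier Ω).Nonempty)
    {μp μm : Measure (E d)} [IsFiniteMeasure μp] [IsFiniteMeasure μm] {c : E d → E d → ℝ}
    (c' : C(E d × E d, ℝ)) (hc' : ∀ p ∈ Ω ×ˢ Ω, c' p = c p.1 p.2) {ψp ψm : E d → ℝ}
    (harb : ∀ x ∈ frontier Ω, ∀ y ∈ frontier Ω, ψm y - ψp x ≤ c x y) (up um : C(E d, ℝ))
    (hup : ∀ x ∈ frontier Ω, up x = ψp x) (hum : ∀ x ∈ frontier Ω, um x = ψm x) {l : ℝ}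
    (hl : 0 ≤ l) (hle : ∀ x ∈ Ω, ∀ y ∈ Ω, -up x + um y ≤ c x y + l) :
    ∃ φ ∈ tightPotentials Ω c ψp ψm, (∫ y in Ω, um y ∂μm) - (∫ x in Ω, up x ∂μp) -
      (μp.real Ω + μm.real Ω) * l ≤ dualValue Ω μp μm φ := by
  have hfΩ : frontier Ω ⊆ Ω := hΩ.isClosed.frontier_subset
  obtain ⟨η, hη, hηl, hη0, hηle⟩ := exists_continuous_modulus hΩ isClosed_frontier hfΩ hne
    (fun p : E d × E d => -up p.1 + um p.2 - c' p) (by fun_prop)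
    (fun x hx y hy => by
      have := harb x hx y hy
      simp only [hc' (x, y) ⟨hfΩ hx, hfΩ hy⟩, hup x hx, hum y hy]
      linarith) hl
    (fun x hx y hy => by
      have := hle x hx y hy
      simp only [hc' (x, y) ⟨hx, hy⟩]
      linarith)
  refine ⟨(fun x => up x + η x, fun y => um y - η y), ⟨by fun_prop, by fun_prop, ?_, ?_⟩, ?_⟩
  · intro x hx
    simp [hη0 x hx, hup x hx, hum x hx]
  · intro x hx y hy
    have := hηle x hx y hy
    simp only [hc' (x, y) ⟨hx, hy⟩] at this
    dsimp only
    linarith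
  · have hint : ∀ (μ : Measure (E d)) [IsFiniteMeasure μ] (g : E d → ℝ), Continuous g →
        IntegrableOn g Ω μ := fun μ _ g hg => hg.continuousOn.integrableOn_compact hΩ
    have hηint : ∀ (μ : Measure (E d)) [IsFiniteMeasure μ], ∫ x in Ω, η x ∂μ ≤ μ.real Ω * l := by
      intro μ _
      calc ∫ x in Ω, η x ∂μ ≤ ∫ _ in Ω, l ∂μ :=
            setIntegral_mono (hint μ η hη) (integrable_const _) hηl
        _ = μ.real Ω * l := by simp
    simp only [dualValue]
    rw [integral_sub (hint μm _ um.continuous) (hint μm _ hη),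
      integral_add (hint μp _ up.continuous) (hint μp _ hη)]
    linarith [hηint μp, hηint μm]

/-- Strong duality against the tight potentials, with primal attainment. -/
theorem exists_plan_isLUB {Ω : Set (E d)} (hΩ : IsCompact Ω) (hne : (frontier Ω).Nonempty)
    {μp μm : Measure (E d)} [IsFiniteMeasure μp] [IsFiniteMeasure μm]
    (hμp : μp (interior Ω)ᶜ = 0) (hμm : μm (interior Ω)ᶜ = 0) {c : E d → E d → ℝ}
    (hc : ContinuousOn (fun p : E d × E d => c p.1 p.2) (Ω ×ˢ Ω)) {ψp ψm : E d → ℝ}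
    (hψp : ContinuousOn ψp (frontier Ω)) (hψm : ContinuousOn ψm (frontier Ω))
    (harb : ∀ x ∈ frontier Ω, ∀ y ∈ frontier Ω, ψm y - ψp x ≤ c x y) :
    ∃ π ∈ plans Ω μp μm,
      IsLUB (dualValue Ω μp μm '' tightPotentials Ω c ψp ψm) (planCost Ω c ψp ψm π) := by
  have hfΩ : frontier Ω ⊆ Ω := hΩ.isClosed.frontier_subset
  have hfm : MeasurableSet (frontier Ω) := isClosed_frontier.measurableSet
  have hK : IsCompact (Ω ×ˢ Ω) := hΩ.prod hΩ
  have : CompactSpace (Ω ×ˢ Ω : Set (E d × E d)) := isCompact_iff_compactSpace.1 hK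
  obtain ⟨c', hc'⟩ := ContinuousMap.exists_restrict_eq hK.isClosed ⟨_, hc.domRestrict⟩
  obtain ⟨Ψp, hΨp⟩ := ContinuousMap.exists_restrict_eq isClosed_frontier ⟨_, hψp.domRestrict⟩
  obtain ⟨Ψm, hΨm⟩ := ContinuousMap.exists_restrict_eq isClosed_frontier ⟨_, hψm.domRestrict⟩
  replace hc' : ∀ p ∈ Ω ×ˢ Ω, c' p = c p.1 p.2 := fun p hp => DFunLike.congr_fun hc' ⟨p, hp⟩
  replace hΨp : ∀ x ∈ frontier Ω, Ψp x = ψp x := fun x hx => DFunLike.congr_fun hΨp ⟨x, hx⟩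
  replace hΨm : ∀ x ∈ frontier Ω, Ψm x = ψm x := fun x hx => DFunLike.congr_fun hΨm ⟨x, hx⟩
  have hbound : ∀ π ∈ plans Ω μp μm,
      planCost Ω c ψp ψm π ∈ upperBounds (dualValue Ω μp μm '' tightPotentials Ω c ψp ψm) := by
    rintro π hπ _ ⟨φ, ⟨h1, h2, h3, h4⟩, rfl⟩
    exact dualValue_le_planCost hΩ hπ hc hψp hψm h1 h2 (fun x hx => (h3 x hx).1.le)
      (fun x hx => (h3 x hx).2.ge) h4
  have hbdd : BddAbove (dualValue Ω μp μm '' tightPotentials Ω c ψp ψm) := by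
    obtain ⟨x₀, hx₀⟩ := hne
    obtain ⟨π, hπ⟩ := plans_nonempty hΩ hx₀ hμp hμm
    exact ⟨_, hbound π hπ⟩
  -- Marginals are prescribed only in the interior, so test functions vanish on the frontier.
  -- Potentials are written `Ψ + v`, which moves the tariffs into the cost `C` and shifts the dual
  -- bound by the integrals of `Ψp` and `Ψm`.
  let V : Submodule ℝ C(E d, ℝ) :=
    { carrier := {g | ∀ x ∈ frontier Ω, g x = 0}
      zero_mem' := fun _ _ => rfl
      add_mem' := fun hg hg' x hx => by simp [hg x hx, hg' x hx]
      smul_mem' := fun a g hg x hx => by simp [hg x hx] }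
  let A : (V × V) →ₗ[ℝ] C((Ω ×ˢ Ω : Set (E d × E d)), ℝ) :=
    { toFun := fun v => ⟨fun p => -v.1.1 p.1.1 + v.2.1 p.1.2, by fun_prop⟩
      map_add' := fun v v' => by ext p; simp; ring
      map_smul' := fun a v => by ext p; simp; ring }
  let f : (V × V) →ₗ[ℝ] ℝ :=
    setIntegralLinear hΩ μm ∘ₗ V.subtype ∘ₗ LinearMap.snd ℝ V V -
      setIntegralLinear hΩ μp ∘ₗ V.subtype ∘ₗ LinearMap.fst ℝ V V
  have hf : ∀ v, f v = (∫ y in Ω, v.2.1 y ∂μm) - ∫ x in Ω, v.1.1 x ∂μp := fun _ => rfl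
  let C : C((Ω ×ˢ Ω : Set (E d × E d)), ℝ) :=
    ⟨fun p => c' p.1 + Ψp p.1.1 - Ψm p.1.2, by fun_prop⟩
  have hCint : ∀ (μ : Measure (E d)) [IsFiniteMeasure μ] (g : C(E d, ℝ)),
      IntegrableOn g Ω μ := fun μ _ g => g.continuous.continuousOn.integrableOn_compact hΩ
  obtain ⟨ρ, hρ, hρA, hρC⟩ := exists_measure_of_dual_bound A f C (μp.real Ω + μm.real Ω)
    (sSup (dualValue Ω μp μm '' tightPotentials Ω c ψp ψm) + (∫ x in Ω, Ψp x ∂μp) -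
      ∫ y in Ω, Ψm y ∂μm) fun v l hl hv => by
    obtain ⟨φ, hφ, hφv⟩ := exists_tightPotential (μp := μp) (μm := μm) hΩ hne c' hc' harb
      (Ψp + v.1.1) (Ψm + v.2.1)
      (fun x hx => by simp [hΨp x hx, v.1.2 x hx]) (fun x hx => by simp [hΨm x hx, v.2.2 x hx]) hl
      (fun x hx y hy => by
        have h1 : -v.1.1 x + v.2.1 y ≤ c' (x, y) + Ψp x - Ψm y + l := hv ⟨(x, y), hx, hy⟩
        rw [hc' (x, y) ⟨hx, hy⟩] at h1
        simp only [ContinuousMap.add_apply]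
        linarith)
    have h2 := le_csSup hbdd ⟨φ, hφ, rfl⟩
    simp only [ContinuousMap.add_apply] at hφv
    rw [integral_add (hCint _ _) (hCint _ _), integral_add (hCint _ _) (hCint _ _)] at hφv
    rw [hf]
    linarith
  have hKm : MeasurableSet (Ω ×ˢ Ω) := hK.isClosed.measurableSet
  have hemb : MeasurableEmbedding (Subtype.val : (Ω ×ˢ Ω : Set (E d × E d)) → E d × E d) :=
    MeasurableEmbedding.subtype_coe hKm
  let π : Measure (E d × E d) := ρ.map Subtype.val
  have hπfin : IsFiniteMeasure π := inferInstance
  have hπ0 : π (Ω ×ˢ Ω)ᶜ = 0 := by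
    rw [hemb.map_apply]
    convert measure_empty (μ := ρ)
    ext p
    simp
  have hπint : ∀ g : E d × E d → ℝ, ∫ p in Ω ×ˢ Ω, g p ∂π = ∫ p, g p.1 ∂ρ := by
    intro g
    rw [Measure.restrict_eq_self_of_ae_mem (by rw [ae_iff]; exact hπ0), hemb.integral_map]
  have hae : ∀ᵐ p ∂π, p ∈ Ω ×ˢ Ω := by rw [ae_iff]; exact hπ0
  have hmarg : ∀ (q : E d × E d → E d), Continuous q → (∀ p ∈ Ω ×ˢ Ω, q p ∈ Ω) →
      ∀ g : C(E d, ℝ), ∫ x in Ω, g x ∂π.map q = ∫ p, g (q p.1) ∂ρ := by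
    intro q hq hqΩ g
    rw [setIntegral_map hΩ.isClosed.measurableSet g.continuous.aestronglyMeasurable
      hq.measurable.aemeasurable, ← hπint fun p => g (q p)]
    refine setIntegral_congr_set ?_
    filter_upwards [hae] with p hp
    exact propext ⟨fun _ => hp, fun _ => hqΩ p hp⟩
  have hfst : π.fst.restrict (interior Ω) = μp := by
    refine restrict_interior_eq_of_integral_eq hΩ.isClosed hne hμp fun g hg => ?_
    rw [Measure.fst, hmarg Prod.fst continuous_fst (fun p hp => hp.1)]
    have h1 := hρA (⟨g, hg⟩, 0)
    rw [hf] at h1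
    simp only [A, LinearMap.coe_mk, AddHom.coe_mk, ContinuousMap.coe_mk, ZeroMemClass.coe_zero,
      ContinuousMap.zero_apply, add_zero, integral_neg, integral_zero, zero_sub, neg_inj] at h1
    exact h1
  have hsnd : π.snd.restrict (interior Ω) = μm := by
    refine restrict_interior_eq_of_integral_eq hΩ.isClosed hne hμm fun g hg => ?_
    rw [Measure.snd, hmarg Prod.snd continuous_snd (fun p hp => hp.2)]
    have h1 := hρA (0, ⟨g, hg⟩)
    rw [hf] at h1
    simp only [A, LinearMap.coe_mk, AddHom.coe_mk, ContinuousMap.coe_mk, ZeroMemClass.coe_zero,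
      ContinuousMap.zero_apply, neg_zero, zero_add, integral_zero, sub_zero] at h1
    exact h1
  have hπ : π ∈ plans Ω μp μm := ⟨hπfin, hπ0, hfst, hsnd⟩
  have hcost : planCost Ω c ψp ψm π ≤
      sSup (dualValue Ω μp μm '' tightPotentials Ω c ψp ψm) := by
    obtain ⟨i1, e1⟩ := setIntegral_fst hΩ hπ Ψp.continuous.continuousOn
    obtain ⟨i2, e2⟩ := setIntegral_snd hΩ hπ Ψm.continuous.continuousOn
    have i0 : IntegrableOn (fun p : E d × E d => c p.1 p.2) (Ω ×ˢ Ω) π := hc.integrableOn_compact hK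
    have h1 : ∫ p, C p ∂ρ = (∫ p in Ω ×ˢ Ω, c p.1 p.2 ∂π) + (∫ p in Ω ×ˢ Ω, Ψp p.1 ∂π) -
        ∫ p in Ω ×ˢ Ω, Ψm p.2 ∂π := by
      rw [← integral_add i0 i1,
        ← integral_sub (f := fun p : E d × E d => c p.1 p.2 + Ψp p.1) (i0.add i1) i2, hπint]
      refine integral_congr_ae (Filter.Eventually.of_forall fun p => ?_)
      simp only [C, ContinuousMap.coe_mk, hc' p.1 p.2]
    have h2 : ∫ x in frontier Ω, Ψp x ∂π.fst = ∫ x in frontier Ω, ψp x ∂π.fst :=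
      setIntegral_congr_fun hfm hΨp
    have h3 : ∫ x in frontier Ω, Ψm x ∂π.snd = ∫ x in frontier Ω, ψm x ∂π.snd :=
      setIntegral_congr_fun hfm hΨm
    simp only [planCost]
    linarith
  -- The extensions `Ψp`, `Ψm` violate the constraint by at most `‖C‖`, hence can be repaired.
  have hnonempty : (tightPotentials Ω c ψp ψm).Nonempty := by
    obtain ⟨φ, hφ, -⟩ := exists_tightPotential (μp := μp) (μm := μm) hΩ hne c' hc' harb Ψp Ψm
      hΨp hΨm (norm_nonneg C) fun x hx y hy => by
        have h1 := neg_le_of_abs_le (C.norm_coe_le_norm ⟨(x, y), hx, hy⟩)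
        have h2 : C ⟨(x, y), hx, hy⟩ = c' (x, y) + Ψp x - Ψm y := rfl
        rw [h2, hc' (x, y) ⟨hx, hy⟩] at h1
        linarith
    exact ⟨φ, hφ⟩
  exact ⟨π, hπ, hbound π hπ, fun b hb => hcost.trans (csSup_le (hnonempty.image _) hb)⟩

end TariffTransport

/-! ### The main theorem -/

theorem mainTheorem2 (d : ℕ) (hd : 1 ≤ d) (Ω : Set (TariffTransport.E d)) (hΩ : IsCompact Ω)
    (μp μm : Measure (TariffTransport.E d)) [IsFiniteMeasure μp] [IsFiniteMeasure μm]
    (hμp : μp (interior Ω)ᶜ = 0) (hμm : μm (interior Ω)ᶜ = 0)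
    (c : TariffTransport.E d → TariffTransport.E d → ℝ)
    (hc : ∃ K : NNReal, LipschitzOnWith K
      (fun p : TariffTransport.E d × TariffTransport.E d => c p.1 p.2) (Ω ×ˢ Ω))
    (ψp ψm : TariffTransport.E d → ℝ)
    (hψp : ContinuousOn ψp (frontier Ω)) (hψm : ContinuousOn ψm (frontier Ω))
    (harb : ∀ x ∈ frontier Ω, ∀ y ∈ frontier Ω, ψm y - ψp x ≤ c x y) :
    (∃ π ∈ TariffTransport.plans Ω μp μm,
      (TariffTransport.planCost Ω c ψp ψm π : EReal) = TariffTransport.T1 Ω c μp μm ψp ψm) ∧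
    ((∀ x ∈ frontier Ω, ψm x ≤ ψp x) →
      TariffTransport.T1 Ω c μp μm ψp ψm = TariffTransport.D1 Ω c μp μm ψp ψm) := by
  open TariffTransport in
  obtain ⟨K, hK⟩ := hc
  have hc := hK.continuousOn
  have hcase : ∃ π ∈ plans Ω μp μm,
      IsLUB (dualValue Ω μp μm '' tightPotentials Ω c ψp ψm) (planCost Ω c ψp ψm π) := by
    -- The duality argument needs a frontier point; for nonempty compact `Ω` it exists because `d ≥
    -- 1` gives `Ω ≠ univ`.
    rcases Ω.eq_empty_or_nonempty with rfl | hne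
    · have hp : μp = 0 := by simpa using hμp
      have hm : μm = 0 := by simpa using hμm
      subst hp hm
      have h0 : planCost ∅ c ψp ψm (0 : Measure (E d × E d)) = 0 := by simp [planCost]
      refine ⟨0, ⟨inferInstance, by simp, by simp, by simp⟩, ?_⟩
      rw [h0]
      refine ⟨?_, fun b hb => hb ⟨(0, 0), by simp [tightPotentials], by simp [dualValue]⟩⟩
      rintro _ ⟨φ, -, rfl⟩
      simp [dualValue]
    · have : Nonempty (Fin d) := ⟨⟨0, hd⟩⟩
      exact exists_plan_isLUB hΩ (nonempty_frontier_iff.2 ⟨hne, hΩ.ne_univ⟩) hμp hμm hc hψp hψm harb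
  obtain ⟨π, hπ, hlub⟩ := hcase
  have hT : T1 Ω c μp μm ψp ψm = planCost Ω c ψp ψm π := by
    refine le_antisymm (iInf₂_le π hπ) (le_iInf₂ fun π' hπ' => EReal.coe_le_coe_iff.2 (hlub.2 ?_))
    rintro _ ⟨φ, ⟨h1, h2, h3, h4⟩, rfl⟩
    exact dualValue_le_planCost hΩ hπ' hc hψp hψm h1 h2 (fun x hx => (h3 x hx).1.le)
      (fun x hx => (h3 x hx).2.ge) h4
  refine ⟨⟨π, hπ, hT.symm⟩, fun hψ => ?_⟩
  rw [hT]
  refine le_antisymm (not_lt.1 fun hlt => ?_) (iSup₂_le fun φ hφ => ?_)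
  · obtain ⟨z, hz, hzπ⟩ := EReal.lt_iff_exists_real_btwn.1 hlt
    refine (EReal.coe_lt_coe_iff.1 hzπ).not_ge (hlub.2 ?_)
    rintro _ ⟨φ, hφ, rfl⟩
    exact EReal.coe_le_coe_iff.1
      ((le_iSup₂_of_le φ (tightPotentials_subset_potentials hψ hφ) le_rfl).trans hz.le)
  · obtain ⟨h1, h2, h3, h4⟩ := hφ
    exact EReal.coe_le_coe_iff.2 (dualValue_le_planCost hΩ hπ hc hψp hψm h1 h2
      (fun x hx => (h3 x hx).2.2) (fun x hx => (h3 x hx).1) h4)
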